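/- Let $0<a_1<a_2<a_3$ and let $c\in(a_1,a_3)$, $c\neq a_2$. Write $\{a_1,a_2,a_3,c\}=\{b_1<b_2<b_3<b_4\}$, $f_i=1/b_i$, and let \[\Gamma:\ \mu^2=-\lambda\prod_{k=1}^4(\lambda-b_k),\qquad P_0=(0,0)\in\Gamma,\] be the genus 2 curve attached to the geodesics on the ellipsoid $X_1^2/a_1+X_2^2/a_2+X_3^2/a_3=1$ that are tangent to the confocal quadric $\sum_i X_i^2/(a_i-c)=1$. Put $\omega_j=\lambda^{j-1}d\lambda/\mu$ ($j=1,2$), and let $\alpha_1,\alpha_2$ be the real ovals of $\Gamma$ over $[b_1,b_2]$ and $[b_3,b_4]$, oriented so that \[\oint_{\alpha_1}\omega_j=2\int_{b_1}^{b_2}\frac{\lambda^{j-1}d\lambda}{\sqrt{-\lambda\prod_k(\lambda-b_k)}},\qquad \oint_{\alpha_2}\omega_j=2\int_{b_3}^{b_4}\frac{\lambda^{j-1}d\lambda}{\sqrt{-\lambda\prod_k(\lambda-b_k)}}.\] The period mapping is $\varphi(c)=\oint_{\alpha_2}\omega_2:\oint_{\alpha_1}\omega_2$ if $c<a_2$,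 and $\varphi(c)=\oint_{\alpha_1}\omega_2:\oint_{\alpha_2}\omega_2$ if $c>a_2$. The real geodesics attached to $\Gamma$ are closed if and only if there are integers $(m_1,m_2)\ne(0,0)$ and a real $T>0$ with \[m_1\oint_{\alpha_1}\omega_1+m_2\oint_{\alpha_2}\omega_1=T,\qquad m_1\oint_{\alpha_1}\omega_2+m_2\oint_{\alpha_2}\omega_2=0;\tag{P}\] (P) is called the real periodicity condition. Assume that $(\Gamma,P_0)$ is a real hyperelliptic tangential cover of degree 4: there is a covering $\pi:\Gamma\to\mathcal E$ of degree $4$ onto an elliptic curve $\mathcal E:\ W^2=4Z^3-g_2Z-g_3$ with $g_2,g_3\in\mathbb R$ that maps $P_0$ to the point at infinity $Q_0$ of $\mathcal E$, and the image of $\mathcal E\to{\rm Jac}(\Gamma)$, $Q\mapsto\pi^*(Q-Q_0)$, is tangent at the origin to the image of $\Gamma$ under the Abel map with base point $P_0$. Consider the conditions \[(A)\quad\begin{cases}81(f_2^2+f_3^2)+62f_2f_3+36(f_1+f_4)^2-108(f_2+f_3)(f_1+f_4)=0,\\ 81(f_1^2+f_4^2)+62f_1f_4+36(f_2+f_3)^2-108(f_2+f_3)(f_1+f_4)=0,\end{cases}\]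 \[(B)\quad\begin{cases}100f_4f_3+8f_1(f_4+f_3+8f_1-9f_2)-(9f_4+9f_3-6f_2)^2=0,\\ (6f_4+6f_3-9f_2)^2+8f_1(9f_4+9f_3-8f_1-f_2)=0.\end{cases}\] If (A) holds, then (P) holds and the period mapping is $3:1$ or $1:3$; precisely, $\varphi(c)=3$ if $c<a_2$ and $\varphi(c)=1/3$ if $c>a_2$. If (B) holds, then (P) holds and the period mapping is $2:1$ or $1:2$; precisely, $\varphi(c)=2$ if $c<a_2$ and $\varphi(c)=1/2$ if $c>a_2$. -/

import Mathlib

open Polynomial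

noncomputable section

/-- The finite nonzero branch points `b₁ < b₂ < b₃ < b₄` (with indices `0, 1, 2, 3`) attached to
the ellipsoid `X₁²/a₁ + X₂²/a₂ + X₃²/a₃ = 1` and to the caustic parameter `c`, that is, the numbers
`a₁, a₂, a₃, c` in increasing order when `0 < a₁ < a₂ < a₃`, `a₁ < c < a₃`, `c ≠ a₂`. -/
def branchPoints (a₁ a₂ a₃ c : ℝ) : Fin 4 → ℝ :=
  if c < a₂ then ![a₁, c, a₂, a₃] else ![a₁, a₂, c, a₃]

/-- The polynomial `-λ (λ - b₁) (λ - b₂) (λ - b₃) (λ - b₄)`; the curve `Γ` is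
`μ² = curvePoly b`, and `P₀ = (0, 0)` is its marked point. -/
def curvePoly (b : Fin 4 → ℝ) : ℝ[X] :=
  -(X * ∏ i, (X - C (b i)))

/-- The period of `ω_j = λ^(j-1) dλ / μ` over the real oval `α₁` of `Γ`, which lies over
`[b₁, b₂]` and is oriented so that `dλ / μ` is positive. -/
def alphaPeriod₁ (b : Fin 4 → ℝ) (j : ℕ) : ℝ :=
  2 * ∫ x in (b 0)..(b 1), x ^ (j - 1) / Real.sqrt ((curvePoly b).eval x)

/-- The period of `ω_j = λ^(j-1) dλ / μ` over the real oval `α₂` of `Γ`, which lies over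
`[b₃, b₄]` and is oriented so that `dλ / μ` is positive. -/
def alphaPeriod₂ (b : Fin 4 → ℝ) (j : ℕ) : ℝ :=
  2 * ∫ x in (b 2)..(b 3), x ^ (j - 1) / Real.sqrt ((curvePoly b).eval x)

/-- The real periodicity condition, which characterizes closedness of the real geodesics attached to
the curve `Γ`. -/
def RealPeriodicity (b : Fin 4 → ℝ) : Prop :=
  ∃ (m₁ m₂ : ℤ) (T : ℝ), (m₁, m₂) ≠ (0, 0) ∧ 0 < T ∧
    m₁ * alphaPeriod₁ b 1 + m₂ * alphaPeriod₂ b 1 = T ∧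
    m₁ * alphaPeriod₁ b 2 + m₂ * alphaPeriod₂ b 2 = 0

/-- The period mapping `φ(c)` of the ellipsoid with squared semiaxes `a₁ < a₂ < a₃`. -/
def periodMapping (a₁ a₂ a₃ c : ℝ) : ℝ :=
  if c < a₂ then
    (2 * alphaPeriod₂ (branchPoints a₁ a₂ a₃ c) 2) / (2 * alphaPeriod₁ (branchPoints a₁ a₂ a₃ c) 2)
  else
    (2 * alphaPeriod₁ (branchPoints a₁ a₂ a₃ c) 2) / (2 * alphaPeriod₂ (branchPoints a₁ a₂ a₃ c) 2)

/-- The value at `x` of the derivative of the rational function `R`. -/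
def ratFuncDerivEval (R : RatFunc ℂ) (x : ℂ) : ℂ :=
  (R.num.derivative.eval x * R.denom.eval x - R.num.eval x * R.denom.derivative.eval x) /
    (R.denom.eval x) ^ 2

/-- `(Γ, P₀)` is a real hyperelliptic tangential cover of degree `N`: there is a covering
`π : Γ → 𝓔` of degree `N` onto an elliptic curve `𝓔 : W² = 4 Z³ - g₂ Z - g₃` with `g₂, g₃` real,
which maps `P₀` to the point at infinity of `𝓔` and is such that the image of
`𝓔 → Jac Γ, Q ↦ π^* (Q - π P₀)`, is tangent at the origin to `Γ ⊂ Jac Γ`.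

Since `P₀` is fixed by the hyperelliptic involution, `π` takes this involution to `W ↦ -W`, so that
`π (λ, μ) = (R λ, μ * S λ)` with rational functions `R, S`, and the degree of `π` is that of `R`.
The tangent of `Γ` at the origin is the direction `(1, 0)` in the coordinates dual to `ω₁, ω₂`;
the tangent of the image of `𝓔` has the coordinates `Tr_π ω₁, Tr_π ω₂` (divided by `dZ / W`). The
tangency therefore says `Tr_π (λ dλ / μ) = 0`. Over a generic point `(z, W)` the fibre of `π` is
`{(x, W / S x) : R x = z}`, and the trace there is `∑ x * S x / R' x` times `dZ / W`. -/
def IsRealTangentialCover (b : Fin 4 → ℝ) (N : ℕ) : Prop :=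
  ∃ (g₂ g₃ : ℝ) (R S : RatFunc ℂ),
    g₂ ^ 3 - 27 * g₃ ^ 2 ≠ 0 ∧
    algebraMap ℂ[X] (RatFunc ℂ) ((curvePoly b).map (algebraMap ℝ ℂ)) * S ^ 2 =
      4 * R ^ 3 - RatFunc.C (g₂ : ℂ) * R - RatFunc.C (g₃ : ℂ) ∧
    R.denom.eval 0 = 0 ∧
    max R.num.natDegree R.denom.natDegree = N ∧
    ∀ᶠ z : ℂ in Filter.cofinite,
      ((R.num - C z * R.denom).roots.map
        (fun x => x * RatFunc.eval (RingHom.id ℂ) x S / ratFuncDerivEval R x)).sum = 0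

/-- Condition (A), in terms of `f_i = 1 / b_i`. -/
def ConditionA (f₁ f₂ f₃ f₄ : ℝ) : Prop :=
  81 * (f₂ ^ 2 + f₃ ^ 2) + 62 * (f₂ * f₃) + 36 * (f₁ + f₄) ^ 2
      - 108 * (f₂ + f₃) * (f₁ + f₄) = 0 ∧
  81 * (f₁ ^ 2 + f₄ ^ 2) + 62 * (f₁ * f₄) + 36 * (f₂ + f₃) ^ 2
      - 108 * (f₂ + f₃) * (f₁ + f₄) = 0

/-- Condition (B), in terms of `f_i = 1 / b_i`. -/
def ConditionB (f₁ f₂ f₃ f₄ : ℝ) : Prop :=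
  100 * f₄ * f₃ + 8 * f₁ * (f₄ + f₃ + 8 * f₁ - 9 * f₂) - (9 * f₄ + 9 * f₃ - 6 * f₂) ^ 2 = 0 ∧
  (6 * f₄ + 6 * f₃ - 9 * f₂) ^ 2 + 8 * f₁ * (9 * f₄ + 9 * f₃ - 8 * f₁ - f₂) = 0

end

/-! Putting x = 1/λ turns ω₂ into a constant multiple of dx/y on y² = −x∏(x − f_k). The point is
that this differential is elliptic. Under (A) with t = x, or under (B) with t = f₁ − x, there is a
degree 4 function w(t), `coverFun`, such that w, w − M and w + K, where M = 4(s−r)³ and K =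
4r(r+3s)², have enough double zeros to make w(w−M)(w+K) equal to t∏(t−F_k)·(w'/3)²
(`const_identity`). So dt/y is pulled back from an elliptic curve, and a period is found by counting
how often w sweeps a real interval.

Under (A), w sweeps [0, M] three times on [F₄, F₃] and once on [F₂, F₁] (`integral_eq_three_mul`).
Under (B), it sweeps [−K, 0] twice on [F₃, F₂], and on (0, F₄] it sweeps [M, ∞) once; a translation
of order two carries [M, ∞) to (−K, 0] (`integral_zero_F₄`, `integral_eq_two_mul`).

With the ω₂-periods in ratio n, the cycle nα₁ − α₂ gives (P). Its ω₁-period is positive because λ ≤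
b₂ on α₁ and λ ≥ b₃ on α₂. -/

open MeasureTheory Set

/-! ### Changes of variables and integrability at the branch points -/

/-- Change of variables along an increasing function on an open interval, without any
integrability assumption. -/
theorem integral_eq_of_deriv_pos {p q : ℝ} (hpq : p < q) {G G' g h : ℝ → ℝ}
    (hc : ContinuousOn G (Icc p q)) (hd : ∀ x ∈ Ioo p q, HasDerivAt G (G' x) x)
    (hpos : ∀ x ∈ Ioo p q, 0 < G' x) (hg : ∀ x ∈ Ioo p q, g x = G' x * h (G x)) :
    ∫ x in p..q, g x = ∫ y in (G p)..(G q), h y := by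
  have hmono : StrictMonoOn G (Icc p q) := by
    refine strictMonoOn_of_deriv_pos (convex_Icc p q) hc fun x hx => ?_
    rw [interior_Icc] at hx
    rw [(hd x hx).deriv]
    exact hpos x hx
  have hGpq : G p < G q := hmono (left_mem_Icc.2 hpq.le) (right_mem_Icc.2 hpq.le) hpq
  have himage : G '' Ioo p q = Ioo (G p) (G q) := by
    apply Subset.antisymm
    · rintro _ ⟨x, hx, rfl⟩
      exact ⟨hmono (left_mem_Icc.2 hpq.le) (Ioo_subset_Icc_self hx) hx.1,
        hmono (Ioo_subset_Icc_self hx) (right_mem_Icc.2 hpq.le) hx.2⟩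
    · exact intermediate_value_Ioo hpq.le hc
  rw [intervalIntegral.integral_of_le hpq.le, intervalIntegral.integral_of_le hGpq.le,
    integral_Ioc_eq_integral_Ioo, integral_Ioc_eq_integral_Ioo, ← himage,
    integral_image_eq_integral_deriv_smul_of_monotoneOn measurableSet_Ioo
      (fun x hx => (hd x hx).hasDerivWithinAt)
      (hmono.monotoneOn.mono Ioo_subset_Icc_self) h]
  exact setIntegral_congr_fun measurableSet_Ioo hg

/-- Change of variables along a decreasing function on an open interval. -/
theorem integral_eq_of_deriv_neg {p q : ℝ} (hpq : p < q) {G G' g h : ℝ → ℝ}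
    (hc : ContinuousOn G (Icc p q)) (hd : ∀ x ∈ Ioo p q, HasDerivAt G (G' x) x)
    (hneg : ∀ x ∈ Ioo p q, G' x < 0) (hg : ∀ x ∈ Ioo p q, g x = -G' x * h (G x)) :
    ∫ x in p..q, g x = ∫ y in (G q)..(G p), h y := by
  rw [integral_eq_of_deriv_pos hpq (G := fun x => -G x) (G' := fun x => -G' x)
    (h := fun y => h (-y)) hc.neg (fun x hx => (hd x hx).neg)
    (fun x hx => neg_pos.2 (hneg x hx)) (fun x hx => by simp [hg x hx]),
    intervalIntegral.integral_comp_neg]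
  simp

/-- The affinely rescaled arcsine is a primitive, continuous up to the endpoints, and a nonnegative
derivative of such a function is integrable. -/
theorem intervalIntegrable_inv_sqrt_mul {p q : ℝ} (hpq : p < q) :
    IntervalIntegrable (fun x => 1 / √((x - p) * (q - x))) volume p q := by
  have hl : 0 < q - p := sub_pos.2 hpq
  have hkey : ∀ x, (x - p) * (q - x) = ((q - p) / 2) ^ 2 * (1 - ((2 * x - p - q) / (q - p)) ^ 2) := by
    intro x
    field_simp
    ring
  have hderiv : ∀ x ∈ Ioo p q, HasDerivAt (fun x => Real.arcsin ((2 * x - p - q) / (q - p)))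
      (1 / √((x - p) * (q - x))) x := by
    intro x hx
    have h1 : (2 * x - p - q) / (q - p) ≠ -1 := by
      rw [ne_eq, div_eq_iff hl.ne']
      intro h
      linarith [hx.1]
    have h2 : (2 * x - p - q) / (q - p) ≠ 1 := by
      rw [ne_eq, div_eq_iff hl.ne']
      intro h
      linarith [hx.2]
    have h3 : HasDerivAt (fun x : ℝ => (2 * x - p - q) / (q - p)) (2 / (q - p)) x := by
      have := ((((hasDerivAt_id x).const_mul 2).sub_const p).sub_const q).div_const (q - p)
      simpa using this
    refine ((Real.hasDerivAt_arcsin h1 h2).comp x h3).congr_deriv ?_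
    rw [hkey, Real.sqrt_mul (sq_nonneg _), Real.sqrt_sq (by linarith)]
    field_simp
  refine intervalIntegral.intervalIntegrable_deriv_of_nonneg
    (g := fun x => Real.arcsin ((2 * x - p - q) / (q - p))) ?_ ?_ ?_
  · exact (Real.continuous_arcsin.comp (by fun_prop)).continuousOn
  · rw [min_eq_left hpq.le, max_eq_right hpq.le]
    exact hderiv
  · intro x _
    positivity

/-- A function with inverse square root singularities at both ends is integrable. -/
theorem intervalIntegrable_div_sqrt {p q : ℝ} (hpq : p < q) {P u v : ℝ → ℝ}
    (hu : ContinuousOn u (Icc p q)) (hpos : ∀ x ∈ Icc p q, 0 < u x)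
    (hv : ContinuousOn v (Icc p q)) (hP : ∀ x ∈ Icc p q, P x = (x - p) * (q - x) * u x) :
    IntervalIntegrable (fun x => v x / √(P x)) volume p q := by
  have hcont : ContinuousOn (fun x => v x / √(u x)) (uIcc p q) := by
    rw [uIcc_of_le hpq.le]
    exact hv.div hu.sqrt fun x hx => (Real.sqrt_pos.2 (hpos x hx)).ne'
  refine ((intervalIntegrable_inv_sqrt_mul hpq).mul_continuousOn hcont).congr fun x hx => ?_
  rw [uIoc_of_le hpq.le] at hx
  have hx' := Ioc_subset_Icc_self hx
  rw [hP x hx', Real.sqrt_mul (mul_nonneg (by linarith [hx'.1]) (by linarith [hx'.2]))]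
  rw [div_mul_div_comm, one_mul]

/-- Pointwise form of the pull-back of dw/(3√Q), with Y in the role of |w'|/3. No sign of X is
needed: if √X = 0, both sides are 0 by the convention 1/0 = 0. -/
theorem inv_sqrt_eq_mul_of_eq_mul_sq {X Y Q : ℝ} (hY : 0 < Y) (hQ : Q = X * Y ^ 2) :
    1 / √X = 3 * Y * (1 / (3 * √Q)) := by
  rw [hQ, mul_comm X, Real.sqrt_mul (sq_nonneg Y), Real.sqrt_sq hY.le]
  by_cases h : √X = 0
  · simp [h]
  · field_simp

/-! ### The degree 4 covering function -/

/-- Branch points `0 < F₄ < F₃ < F₂ < F₁` together with the parameters `r, s` of a degree 4 covering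
of an elliptic curve by `y² = ± t ∏ (t - F_k)`: the functions
`(t - F₂) (t - F₃) (t - r)² / t`, `(t - F₁) (t - F₄) (t - s)² / t` and
`(t² - 3 (r + s) t - 3 r s)² / t` differ by constants. -/
structure CoverData (F₁ F₂ F₃ F₄ r s : ℝ) : Prop where
  pos₄ : 0 < F₄
  lt₄₃ : F₄ < F₃
  lt₃₂ : F₃ < F₂
  lt₂₁ : F₂ < F₁
  add₂₃ : F₂ + F₃ = 6 * s + 4 * r
  mul₂₃ : F₂ * F₃ = 9 * s ^ 2
  add₁₄ : F₁ + F₄ = 6 * r + 4 * s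
  mul₁₄ : F₁ * F₄ = 9 * r ^ 2

/-- The quadratic polynomial whose square is the third numerator of the covering. -/
noncomputable def coverQuad (r s t : ℝ) : ℝ := t ^ 2 - 3 * (r + s) * t - 3 * (r * s)

/-- The covering function `(t - F₂) (t - F₃) (t - r)² / t`. -/
noncomputable def coverFun (r s t : ℝ) : ℝ :=
  (t ^ 2 - (6 * s + 4 * r) * t + 9 * s ^ 2) * (t - r) ^ 2 / t

/-- A third of the derivative of `coverFun`. -/
noncomputable def coverDeriv (r s t : ℝ) : ℝ := (t - r) * (t - s) * coverQuad r s t / t ^ 2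

theorem hasDerivAt_coverFun (r s : ℝ) {t : ℝ} (ht : t ≠ 0) :
    HasDerivAt (coverFun r s) (3 * coverDeriv r s t) t := by
  have h1 : HasDerivAt (fun t : ℝ => t ^ 2 - (6 * s + 4 * r) * t + 9 * s ^ 2)
      (2 * t - (6 * s + 4 * r)) t := by
    have := (((hasDerivAt_id t).pow 2).sub
      ((hasDerivAt_id t).const_mul (6 * s + 4 * r))).add_const (9 * s ^ 2)
    simpa using this
  have h2 : HasDerivAt (fun t : ℝ => (t - r) ^ 2) (2 * (t - r)) t := by
    simpa using ((hasDerivAt_id' t).sub_const r).fun_pow 2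
  refine ((h1.mul h2).div (hasDerivAt_id t) ht).congr_deriv ?_
  simp only [coverDeriv, coverQuad, id, Pi.mul_apply]
  field_simp
  ring

theorem coverFun_sub_const (r s : ℝ) {t : ℝ} (ht : t ≠ 0) :
    coverFun r s t - 4 * (s - r) ^ 3 =
      (t ^ 2 - (6 * r + 4 * s) * t + 9 * r ^ 2) * (t - s) ^ 2 / t := by
  simp only [coverFun]
  field_simp
  ring

theorem coverFun_add_const (r s : ℝ) {t : ℝ} (ht : t ≠ 0) :
    coverFun r s t + 4 * r * (r + 3 * s) ^ 2 = coverQuad r s t ^ 2 / t := by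
  simp only [coverFun, coverQuad]
  field_simp
  ring

/-! ### Positions of r, s and the zeros of w' among the branch points -/

namespace CoverData

variable {F₁ F₂ F₃ F₄ r s : ℝ}

theorem quad₂₃ (h : CoverData F₁ F₂ F₃ F₄ r s) (t : ℝ) :
    t ^ 2 - (6 * s + 4 * r) * t + 9 * s ^ 2 = (t - F₂) * (t - F₃) := by
  rw [← h.add₂₃, ← h.mul₂₃]
  ring

theorem quad₁₄ (h : CoverData F₁ F₂ F₃ F₄ r s) (t : ℝ) :
    t ^ 2 - (6 * r + 4 * s) * t + 9 * r ^ 2 = (t - F₁) * (t - F₄) := by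
  rw [← h.add₁₄, ← h.mul₁₄]
  ring

theorem pos₃ (h : CoverData F₁ F₂ F₃ F₄ r s) : 0 < F₃ := h.pos₄.trans h.lt₄₃

theorem pos₂ (h : CoverData F₁ F₂ F₃ F₄ r s) : 0 < F₂ := h.pos₃.trans h.lt₃₂

theorem pos₁ (h : CoverData F₁ F₂ F₃ F₄ r s) : 0 < F₁ := h.pos₂.trans h.lt₂₁

/-- Vanishing of the first quadratic at F₂ reads (F₂ − 3s)² = 4rF₂, so r ≥ 0; and 9r² = F₁F₄
excludes r = 0. -/
theorem r_pos (h : CoverData F₁ F₂ F₃ F₄ r s) : 0 < r := by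
  have h1 : 4 * r * F₂ = (F₂ - 3 * s) ^ 2 := by linear_combination -h.quad₂₃ F₂
  have h2 : 0 < 9 * r ^ 2 := h.mul₁₄ ▸ mul_pos h.pos₁ h.pos₄
  have h3 : 0 ≤ r := by
    by_contra hr
    nlinarith [mul_pos (neg_pos.2 (not_le.1 hr)) h.pos₂, sq_nonneg (F₂ - 3 * s)]
  refine h3.lt_of_ne fun h0 => ?_
  simp [← h0] at h2

theorem s_pos (h : CoverData F₁ F₂ F₃ F₄ r s) : 0 < s := by
  have h1 : 4 * s * F₁ = (F₁ - 3 * r) ^ 2 := by linear_combination -h.quad₁₄ F₁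
  have h2 : 0 < 9 * s ^ 2 := h.mul₂₃ ▸ mul_pos h.pos₂ h.pos₃
  have h3 : 0 ≤ s := by
    by_contra hs
    nlinarith [mul_pos (neg_pos.2 (not_le.1 hs)) h.pos₁, sq_nonneg (F₁ - 3 * r)]
  refine h3.lt_of_ne fun h0 => ?_
  simp [← h0] at h2

/-- The two quadratics differ by (s − r)(2t − 9(r + s)). At F₂ and F₃ the first vanishes and the
second is negative; adding the two inequalities gives (s − r)(6s + 10r) > 0. -/
theorem r_lt_s (h : CoverData F₁ F₂ F₃ F₄ r s) : r < s := by
  have h2 : (s - r) * (2 * F₂ - 9 * (r + s)) < 0 := by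
    have := mul_pos (sub_pos.2 h.lt₂₁) (sub_pos.2 (h.lt₄₃.trans h.lt₃₂))
    linear_combination this - h.quad₂₃ F₂ + h.quad₁₄ F₂
  have h3 : (s - r) * (2 * F₃ - 9 * (r + s)) < 0 := by
    have := mul_pos (sub_pos.2 (h.lt₃₂.trans h.lt₂₁)) (sub_pos.2 h.lt₄₃)
    linear_combination this - h.quad₂₃ F₃ + h.quad₁₄ F₃
  by_contra hsr
  have h4 : s - r ≤ 0 := by linarith
  have h5 : (s - r) * (2 * (F₂ + F₃) - 18 * (r + s)) < 0 := by linarith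
  rw [h.add₂₃] at h5
  nlinarith [h.r_pos, h.s_pos, mul_nonneg (neg_nonneg.2 h4) (add_pos h.r_pos h.s_pos).le,
    mul_nonneg (neg_nonneg.2 h4) h.r_pos.le]

/-- At r the quadratic with roots F₁, F₄ equals 4r(r − s) < 0, so r lies between them. -/
theorem F₄_lt_r (h : CoverData F₁ F₂ F₃ F₄ r s) : F₄ < r := by
  have h1 : (r - F₁) * (r - F₄) < 0 := by
    rw [← h.quad₁₄]
    nlinarith [mul_pos h.r_pos (sub_pos.2 h.r_lt_s)]
  by_contra h2
  have h3 := h.lt₄₃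
  have h4 := h.lt₃₂
  have h5 := h.lt₂₁
  nlinarith [mul_nonneg (sub_nonneg.2 (not_lt.1 h2)) (by linarith : 0 ≤ F₁ - r)]

/-- At s the quadratic with roots F₂, F₃ equals 4s(s − r) > 0, so s lies outside [F₃, F₂]; it is
below the midpoint 3s + 2r, hence to the left. -/
theorem s_lt_F₃ (h : CoverData F₁ F₂ F₃ F₄ r s) : s < F₃ := by
  have h1 : 0 < (s - F₂) * (s - F₃) := by
    rw [← h.quad₂₃]
    nlinarith [mul_pos h.s_pos (sub_pos.2 h.r_lt_s)]
  by_contra h2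
  have h3 : s < F₂ := by linarith [h.add₂₃, h.lt₃₂, h.r_pos, h.s_pos]
  nlinarith [mul_nonneg (sub_nonneg.2 (not_lt.1 h2)) (sub_pos.2 h3).le]

/-- Modulo the quadratic with roots F₂, F₃, `coverQuad` reduces to (3s + r)(t − 3s), and 3s is the
geometric mean of F₂ and F₃. -/
theorem coverQuad_F₃_neg (h : CoverData F₁ F₂ F₃ F₄ r s) : coverQuad r s F₃ < 0 := by
  have h1 : coverQuad r s F₃ = (3 * s + r) * (F₃ - 3 * s) := by
    rw [coverQuad]
    linear_combination h.quad₂₃ F₃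
  have h2 : F₃ < 3 * s := by nlinarith [h.mul₂₃, h.pos₃, h.lt₃₂, h.s_pos]
  rw [h1]
  exact mul_neg_of_pos_of_neg (by linarith [h.s_pos, h.r_pos]) (by linarith)

theorem coverQuad_F₂_pos (h : CoverData F₁ F₂ F₃ F₄ r s) : 0 < coverQuad r s F₂ := by
  have h1 : coverQuad r s F₂ = (3 * s + r) * (F₂ - 3 * s) := by
    rw [coverQuad]
    linear_combination h.quad₂₃ F₂
  have h2 : 3 * s < F₂ := by nlinarith [h.mul₂₃, h.pos₃, h.lt₃₂, h.s_pos]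
  rw [h1]
  exact mul_pos (by linarith [h.s_pos, h.r_pos]) (by linarith)

/-- The quadratic polynomial is negative to the left of each positive point where it is
nonpositive. -/
theorem coverQuad_neg (h : CoverData F₁ F₂ F₃ F₄ r s) {t x : ℝ} (ht : 0 ≤ t) (htx : t < x)
    (hx : coverQuad r s x ≤ 0) : coverQuad r s t < 0 := by
  -- `coverQuad r s t / t` = t − 3(r+s) − 3rs/t increases on t > 0; denominators are cleared so that
  -- t = 0 is covered too.
  have h1 : x * coverQuad r s t =
      t * coverQuad r s x - (x - t) * (t * x + 3 * (r * s)) := by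
    rw [coverQuad, coverQuad]
    ring
  have h2 : 0 < (x - t) * (t * x + 3 * (r * s)) :=
    mul_pos (sub_pos.2 htx) (by nlinarith [mul_pos h.r_pos h.s_pos, mul_nonneg ht (ht.trans htx.le)])
  have h3 : x * coverQuad r s t < 0 := by
    rw [h1]
    nlinarith [mul_nonneg ht (neg_nonneg.2 hx)]
  exact neg_of_mul_neg_right h3 (ht.trans htx.le)

/-- The quadratic polynomial is positive to the right of each positive point where it is
nonnegative. -/
theorem coverQuad_pos (h : CoverData F₁ F₂ F₃ F₄ r s) {t x : ℝ} (hx0 : 0 ≤ x) (htx : x < t)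
    (hx : 0 ≤ coverQuad r s x) : 0 < coverQuad r s t := by
  by_contra ht
  linarith [h.coverQuad_neg hx0 htx (not_lt.1 ht)]

/-- The double zeros of the three factors supply the square of (t − r)(t − s)·`coverQuad`, and 1/t³
= t·(1/t²)². -/
theorem const_identity (h : CoverData F₁ F₂ F₃ F₄ r s) {t : ℝ} (ht : t ≠ 0) :
    coverFun r s t * (coverFun r s t - 4 * (s - r) ^ 3) *
        (coverFun r s t + 4 * r * (r + 3 * s) ^ 2) =
      t * ((t - F₁) * (t - F₂) * (t - F₃) * (t - F₄)) * coverDeriv r s t ^ 2 := by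
  rw [coverFun_sub_const r s ht, coverFun_add_const r s ht, coverFun, coverDeriv, h.quad₂₃,
    h.quad₁₄]
  field_simp

theorem coverFun_eq_zero (h : CoverData F₁ F₂ F₃ F₄ r s) {t : ℝ} (ht : t = F₂ ∨ t = F₃ ∨ t = r) :
    coverFun r s t = 0 := by
  rw [coverFun, h.quad₂₃]
  rcases ht with rfl | rfl | rfl <;> simp

theorem coverFun_eq_const (h : CoverData F₁ F₂ F₃ F₄ r s) {t : ℝ} (ht0 : t ≠ 0)
    (ht : t = F₁ ∨ t = F₄ ∨ t = s) : coverFun r s t = 4 * (s - r) ^ 3 := by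
  rw [← sub_eq_zero, coverFun_sub_const r s ht0, h.quad₁₄]
  rcases ht with rfl | rfl | rfl <;> simp

theorem continuousOn_coverFun (r s : ℝ) {p q : ℝ} (hp : 0 < p) :
    ContinuousOn (coverFun r s) (Icc p q) := fun _ ht =>
  (hasDerivAt_coverFun r s (hp.trans_le ht.1).ne').continuousAt.continuousWithinAt

/-! ### Real periods as elliptic integrals -/

/-- An elliptic integral on a segment along which `coverFun` increases. -/
theorem integral_of_coverDeriv_pos (h : CoverData F₁ F₂ F₃ F₄ r s) {p q : ℝ} (hp : 0 < p)
    (hpq : p < q) (hD : ∀ t ∈ Ioo p q, 0 < coverDeriv r s t) (ε : ℝ) :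
    ∫ t in p..q, 1 / √(ε * (t * ((t - F₁) * (t - F₂) * (t - F₃) * (t - F₄)))) =
      ∫ w in (coverFun r s p)..(coverFun r s q),
        1 / (3 * √(ε * (w * (w - 4 * (s - r) ^ 3) * (w + 4 * r * (r + 3 * s) ^ 2)))) := by
  refine integral_eq_of_deriv_pos hpq (G' := fun t => 3 * coverDeriv r s t)
    (continuousOn_coverFun r s hp)
    (fun t ht => hasDerivAt_coverFun r s (hp.trans ht.1).ne')
    (fun t ht => mul_pos three_pos (hD t ht)) fun t ht => ?_
  refine inv_sqrt_eq_mul_of_eq_mul_sq (hD t ht) ?_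
  rw [h.const_identity (hp.trans ht.1).ne']
  ring

/-- An elliptic integral on a segment along which `coverFun` decreases. -/
theorem integral_of_coverDeriv_neg (h : CoverData F₁ F₂ F₃ F₄ r s) {p q : ℝ} (hp : 0 < p)
    (hpq : p < q) (hD : ∀ t ∈ Ioo p q, coverDeriv r s t < 0) (ε : ℝ) :
    ∫ t in p..q, 1 / √(ε * (t * ((t - F₁) * (t - F₂) * (t - F₃) * (t - F₄)))) =
      ∫ w in (coverFun r s q)..(coverFun r s p),
        1 / (3 * √(ε * (w * (w - 4 * (s - r) ^ 3) * (w + 4 * r * (r + 3 * s) ^ 2)))) := by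
  refine integral_eq_of_deriv_neg hpq (G' := fun t => 3 * coverDeriv r s t)
    (continuousOn_coverFun r s hp)
    (fun t ht => hasDerivAt_coverFun r s (hp.trans ht.1).ne')
    (fun t ht => by linarith [hD t ht]) fun t ht => ?_
  rw [← mul_neg]
  refine inv_sqrt_eq_mul_of_eq_mul_sq (neg_pos.2 (hD t ht)) ?_
  rw [h.const_identity (hp.trans ht.1).ne']
  ring

/-- The ratio of the two real periods of `dt / y` on `y² = -t ∏ (t - F_k)`. -/
theorem integral_eq_three_mul (h : CoverData F₁ F₂ F₃ F₄ r s) :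
    ∫ t in F₄..F₃, 1 / √(-1 * (t * ((t - F₁) * (t - F₂) * (t - F₃) * (t - F₄)))) =
      3 * ∫ t in F₂..F₁, 1 / √(-1 * (t * ((t - F₁) * (t - F₂) * (t - F₃) * (t - F₄)))) := by
  have hr := h.r_pos
  have hs := h.s_pos
  have hrs := h.r_lt_s
  have h4r := h.F₄_lt_r
  have hs3 := h.s_lt_F₃
  have h4 := h.pos₄
  have h32 := h.lt₃₂
  have h21 := h.lt₂₁
  have hint : IntervalIntegrable
      (fun t => 1 / √(-1 * (t * ((t - F₁) * (t - F₂) * (t - F₃) * (t - F₄))))) volume F₄ F₃ := by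
    refine intervalIntegrable_div_sqrt h.lt₄₃ (u := fun t => t * (F₁ - t) * (F₂ - t))
      (by fun_prop) (fun t ht => ?_) continuousOn_const (fun t _ => by ring)
    exact mul_pos (mul_pos (by linarith [ht.1]) (by linarith [ht.2])) (by linarith [ht.2])
  have hsub : ∀ {x y : ℝ}, F₄ ≤ x → x ≤ y → y ≤ F₃ → IntervalIntegrable
      (fun t => 1 / √(-1 * (t * ((t - F₁) * (t - F₂) * (t - F₃) * (t - F₄))))) volume x y := by
    intro x y hx hxy hy
    refine hint.mono_set ?_
    rw [uIcc_of_le hxy, uIcc_of_le h.lt₄₃.le]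
    exact Icc_subset_Icc hx hy
  have hq : ∀ t, 0 ≤ t → t < F₃ → coverQuad r s t < 0 := fun t h0 h3 =>
    h.coverQuad_neg h0 h3 h.coverQuad_F₃_neg.le
  -- At F₄ < r < s < F₃ the function w takes the values M, 0, M, 0 and is monotone in between.
  rw [← intervalIntegral.integral_add_adjacent_intervals
      (hsub le_rfl (h4r.le.trans hrs.le) hs3.le) (hsub (h4r.le.trans hrs.le) hs3.le le_rfl),
    ← intervalIntegral.integral_add_adjacent_intervals
      (hsub le_rfl h4r.le (hrs.le.trans hs3.le)) (hsub h4r.le hrs.le hs3.le),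
    h.integral_of_coverDeriv_neg h4 h4r, h.integral_of_coverDeriv_pos hr hrs,
    h.integral_of_coverDeriv_neg hs hs3, h.integral_of_coverDeriv_pos h.pos₂ h21,
    h.coverFun_eq_const h4.ne' (.inr (.inl rfl)), h.coverFun_eq_const hs.ne' (.inr (.inr rfl)),
    h.coverFun_eq_const h.pos₁.ne' (.inl rfl), h.coverFun_eq_zero (.inl rfl),
    h.coverFun_eq_zero (.inr (.inl rfl)), h.coverFun_eq_zero (.inr (.inr rfl))]
  · ring
  · intro t ht
    have h0 : 0 < t := by linarith [ht.1, h.pos₂]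
    have := h.coverQuad_pos h.pos₂.le ht.1 h.coverQuad_F₂_pos.le
    exact div_pos (mul_pos (mul_pos (by linarith [ht.1]) (by linarith [ht.1])) this) (pow_pos h0 2)
  · intro t ht
    have h0 : 0 < t := hs.trans ht.1
    exact div_neg_of_neg_of_pos (mul_neg_of_pos_of_neg
      (mul_pos (by linarith [ht.1]) (by linarith [ht.1])) (hq t h0.le ht.2)) (pow_pos h0 2)
  · intro t ht
    have h0 : 0 < t := hr.trans ht.1
    exact div_pos (mul_pos_of_neg_of_neg (mul_neg_of_pos_of_neg (by linarith [ht.1])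
      (by linarith [ht.2])) (hq t h0.le (ht.2.trans hs3))) (pow_pos h0 2)
  · intro t ht
    have h0 : 0 < t := h4.trans ht.1
    exact div_neg_of_neg_of_pos (mul_neg_of_pos_of_neg (mul_pos_of_neg_of_neg (by linarith [ht.2])
      (by linarith [ht.2])) (hq t h0.le (by linarith [ht.2]))) (pow_pos h0 2)

/-- The segment from `0` to `F₄` is mapped to the other oval of the elliptic curve, which is
translated back by a point of order two. -/
theorem integral_zero_F₄ (h : CoverData F₁ F₂ F₃ F₄ r s) :
    ∫ t in (0 : ℝ)..F₄, 1 / √(1 * (t * ((t - F₁) * (t - F₂) * (t - F₃) * (t - F₄)))) =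
      ∫ w in (-(4 * r * (r + 3 * s) ^ 2))..0,
        1 / (3 * √(1 * (w * (w - 4 * (s - r) ^ 3) * (w + 4 * r * (r + 3 * s) ^ 2)))) := by
  set M := 4 * (s - r) ^ 3 with hM
  set K := 4 * r * (r + 3 * s) ^ 2 with hK
  have hr := h.r_pos
  have hs := h.s_pos
  have hrs := h.r_lt_s
  have h4r := h.F₄_lt_r
  have hMpos : 0 < M := mul_pos four_pos (pow_pos (sub_pos.2 hrs) 3)
  have hKpos : 0 < K := by positivity
  have hq : ∀ t, 0 ≤ t → t ≤ F₄ → coverQuad r s t < 0 := fun t h0 ht =>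
    h.coverQuad_neg h0 (ht.trans_lt h.lt₄₃) h.coverQuad_F₃_neg.le
  have hD : ∀ t ∈ Ioo 0 F₄, coverDeriv r s t < 0 := fun t ht =>
    div_neg_of_neg_of_pos (mul_neg_of_pos_of_neg (mul_pos_of_neg_of_neg (by linarith [ht.2])
      (by linarith [ht.2])) (hq t ht.1.le ht.2.le)) (pow_pos ht.1 2)
  have hadd : ∀ {t : ℝ}, 0 < t → coverFun r s t + K = coverQuad r s t ^ 2 / t := fun ht =>
    coverFun_add_const r s ht.ne'
  have hfun : ∀ {t : ℝ}, t ∈ Ioc 0 F₄ → 0 < coverFun r s t + K := fun ht => by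
    rw [hadd ht.1]
    exact div_pos (sq_pos_of_neg (hq _ ht.1.le ht.2)) ht.1
  have heq : ∀ {t : ℝ}, t ∈ Ioc 0 F₄ →
      K * (M + K) * t / coverQuad r s t ^ 2 - K = K * (M + K) / (coverFun r s t + K) - K := by
    intro t ht
    rw [hadd ht.1, div_div_eq_mul_div]
  -- G is w followed by w ↦ K(M+K)/(w+K) − K, the translation by the 2-torsion point over −K, which
  -- sends ∞ to −K and M to 0. Written through `coverQuad`, it is continuous at t = 0, where w has
  -- its pole.
  have hsubst := integral_eq_of_deriv_pos h.pos₄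
    (G := fun t => K * (M + K) * t / coverQuad r s t ^ 2 - K)
    (G' := fun t => 3 * (K * (M + K) * -coverDeriv r s t / (coverFun r s t + K) ^ 2))
    (g := fun t => 1 / √(1 * (t * ((t - F₁) * (t - F₂) * (t - F₃) * (t - F₄)))))
    (h := fun w => 1 / (3 * √(1 * (w * (w - M) * (w + K))))) ?_ ?_ ?_ ?_
  · have h0 : K * (M + K) * 0 / coverQuad r s 0 ^ 2 - K = -K := by simp
    have h1 : K * (M + K) * F₄ / coverQuad r s F₄ ^ 2 - K = 0 := by
      rw [heq ⟨h.pos₄, le_rfl⟩, h.coverFun_eq_const h.pos₄.ne' (.inr (.inl rfl)), ← hM,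
        mul_div_assoc, div_self (by linarith), mul_one, sub_self]
    simp only [h0, h1] at hsubst
    exact hsubst
  · refine ContinuousOn.sub (ContinuousOn.div (by fun_prop) ?_ fun t ht =>
      pow_ne_zero 2 (hq t ht.1 ht.2).ne) continuousOn_const
    unfold coverQuad
    fun_prop
  · intro t ht
    have hd := (((hasDerivAt_coverFun r s ht.1.ne').add_const K).inv
      (hfun (Ioo_subset_Ioc_self ht)).ne').const_mul (K * (M + K)) |>.sub_const K
    refine (hd.congr_of_eventuallyEq ?_).congr_deriv (by ring)
    filter_upwards [isOpen_Ioo.mem_nhds ht] with x hx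
    simpa [div_eq_mul_inv] using heq (Ioo_subset_Ioc_self hx)
  · intro t ht
    have h1 := hfun (Ioo_subset_Ioc_self ht)
    have h2 := neg_pos.2 (hD t ht)
    positivity
  · intro t ht
    have h1 := hfun (Ioo_subset_Ioc_self ht)
    have h2 := neg_pos.2 (hD t ht)
    refine inv_sqrt_eq_mul_of_eq_mul_sq (by positivity) ?_
    rw [heq (Ioo_subset_Ioc_self ht), one_mul, one_mul]
    have h3 := h.const_identity ht.1.ne'
    rw [← hM, ← hK] at h3
    clear_value M K
    generalize coverFun r s t = w at h1 h3 ⊢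
    generalize coverDeriv r s t = D at h3 ⊢
    generalize t * ((t - F₁) * (t - F₂) * (t - F₃) * (t - F₄)) = P at h3 ⊢
    -- The translation preserves the invariant differential: the cubic at the image point is the
    -- cubic at w times the squared derivative of the translation.
    trans (K * (M + K)) ^ 2 * (w * (w - M) * (w + K)) / (w + K) ^ 4
    · field_simp
      ring
    · rw [h3]
      field_simp

/-- The ratio of the two real periods of `dt / y` on `y² = t ∏ (t - F_k)`. -/
theorem integral_eq_two_mul (h : CoverData F₁ F₂ F₃ F₄ r s) :
    ∫ t in F₃..F₂, 1 / √(1 * (t * ((t - F₁) * (t - F₂) * (t - F₃) * (t - F₄)))) =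
      2 * ∫ t in (0 : ℝ)..F₄, 1 / √(1 * (t * ((t - F₁) * (t - F₂) * (t - F₃) * (t - F₄)))) := by
  have hrs := h.r_lt_s
  have hs3 := h.s_lt_F₃
  have h3 := h.pos₃
  have h43 := h.lt₄₃
  have h32 := h.lt₃₂
  have h21 := h.lt₂₁
  have hint : IntervalIntegrable
      (fun t => 1 / √(1 * (t * ((t - F₁) * (t - F₂) * (t - F₃) * (t - F₄))))) volume F₃ F₂ := by
    refine intervalIntegrable_div_sqrt h.lt₃₂ (u := fun t => t * (F₁ - t) * (t - F₄))
      (by fun_prop) (fun t ht => ?_) continuousOn_const (fun t _ => by ring)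
    exact mul_pos (mul_pos (by linarith [ht.1]) (by linarith [ht.2])) (by linarith [ht.1])
  -- Since r and s lie left of F₃, the sign of w' on [F₃, F₂] is that of `coverQuad`; w falls from 0
  -- to −K at x and climbs back to 0.
  obtain ⟨x, hx, hqx⟩ : ∃ x ∈ Ioo F₃ F₂, coverQuad r s x = 0 := by
    refine intermediate_value_Ioo h32.le ?_ ⟨h.coverQuad_F₃_neg, h.coverQuad_F₂_pos⟩
    unfold coverQuad
    fun_prop
  have hx0 : 0 < x := h3.trans hx.1
  have hsub : ∀ {y z : ℝ}, F₃ ≤ y → y ≤ z → z ≤ F₂ → IntervalIntegrable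
      (fun t => 1 / √(1 * (t * ((t - F₁) * (t - F₂) * (t - F₃) * (t - F₄))))) volume y z := by
    intro y z hy hyz hz
    refine hint.mono_set ?_
    rw [uIcc_of_le hyz, uIcc_of_le h32.le]
    exact Icc_subset_Icc hy hz
  have hval : coverFun r s x = -(4 * r * (r + 3 * s) ^ 2) := by
    rw [← add_eq_zero_iff_eq_neg, coverFun_add_const r s hx0.ne', hqx]
    simp
  rw [h.integral_zero_F₄, ← intervalIntegral.integral_add_adjacent_intervals
      (hsub le_rfl hx.1.le hx.2.le) (hsub hx.1.le hx.2.le le_rfl),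
    h.integral_of_coverDeriv_neg h3 hx.1, h.integral_of_coverDeriv_pos hx0 hx.2,
    h.coverFun_eq_zero (.inl rfl), h.coverFun_eq_zero (.inr (.inl rfl)), hval]
  · ring
  · intro t ht
    have h0 : 0 < t := hx0.trans ht.1
    exact div_pos (mul_pos (mul_pos (by linarith [ht.1, hx.1]) (by linarith [ht.1, hx.1]))
      (h.coverQuad_pos hx0.le ht.1 hqx.ge)) (pow_pos h0 2)
  · intro t ht
    have h0 : 0 < t := h3.trans ht.1
    exact div_neg_of_neg_of_pos (mul_neg_of_pos_of_neg
      (mul_pos (by linarith [ht.1]) (by linarith [ht.1]))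
      (h.coverQuad_neg h0.le ht.2 hqx.le)) (pow_pos h0 2)

end CoverData

/-! ### From the curve Γ to covering data -/

theorem curvePoly_eval (b : Fin 4 → ℝ) (x : ℝ) :
    (curvePoly b).eval x = -1 * (x * ((x - b 0) * (x - b 1) * (x - b 2) * (x - b 3))) := by
  simp [curvePoly, Fin.prod_univ_four]

/-- The substitution `x = 1 / λ` takes `λ dλ / μ` to a multiple of the differential `dx / y` of the
curve `y² = -x ∏ (x - 1 / b_k)`. -/
theorem integral_curvePoly_eq_mul_integral {b : Fin 4 → ℝ} (hb : ∀ i, 0 < b i) {p q : ℝ}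
    (hp : 0 < p) (hpq : p < q) :
    ∫ x in p..q, x ^ (2 - 1) / √((curvePoly b).eval x) =
      1 / √(b 0 * b 1 * b 2 * b 3) * ∫ x in (1 / q)..(1 / p), 1 / √(-1 * (x *
        ((x - 1 / b 0) * (x - 1 / b 1) * (x - 1 / b 2) * (x - 1 / b 3)))) := by
  have h0 := hb 0
  have h1 := hb 1
  have h2 := hb 2
  have h3 := hb 3
  rw [← intervalIntegral.integral_const_mul]
  refine integral_eq_of_deriv_neg hpq (G := fun x => 1 / x) (G' := fun x => -(x ^ 2)⁻¹) ?_ ?_ ?_ ?_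
  · exact continuousOn_const.div continuousOn_id fun x hx => (hp.trans_le hx.1).ne'
  · intro x hx
    simpa using hasDerivAt_inv (hp.trans hx.1).ne'
  · intro x hx
    exact neg_neg_of_pos (inv_pos.2 (pow_pos (hp.trans hx.1) 2))
  · intro x hx
    have hx0 : 0 < x := hp.trans hx.1
    have hB : 0 < b 0 * b 1 * b 2 * b 3 := by positivity
    have hkey : (curvePoly b).eval x = (x ^ 3) ^ 2 * (b 0 * b 1 * b 2 * b 3) * (-1 * (1 / x *
        ((1 / x - 1 / b 0) * (1 / x - 1 / b 1) * (1 / x - 1 / b 2) * (1 / x - 1 / b 3)))) := by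
      rw [curvePoly_eval]
      field_simp
      ring
    rw [hkey, Real.sqrt_mul (by positivity), Real.sqrt_mul (by positivity),
      Real.sqrt_sq (by positivity)]
    have hB' : √(b 0 * b 1 * b 2 * b 3) ≠ 0 := (Real.sqrt_pos.2 hB).ne'
    generalize √(-1 * (1 / x * ((1 / x - 1 / b 0) * (1 / x - 1 / b 1) * (1 / x - 1 / b 2) *
      (1 / x - 1 / b 3)))) = Y
    by_cases hY : Y = 0
    · simp [hY]
    · field_simp
      norm_num

/-- The two sum relations are linear in r, s and determine them; the two product relations are then
the equations of (A). -/
theorem ConditionA.coverData {f₁ f₂ f₃ f₄ : ℝ} (h : ConditionA f₁ f₂ f₃ f₄) (h₄ : 0 < f₄)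
    (h₄₃ : f₄ < f₃) (h₃₂ : f₃ < f₂) (h₂₁ : f₂ < f₁) :
    CoverData f₁ f₂ f₃ f₄ ((3 * (f₁ + f₄) - 2 * (f₂ + f₃)) / 10)
      ((3 * (f₂ + f₃) - 2 * (f₁ + f₄)) / 10) where
  pos₄ := h₄
  lt₄₃ := h₄₃
  lt₃₂ := h₃₂
  lt₂₁ := h₂₁
  add₂₃ := by ring
  mul₂₃ := by linear_combination -h.1 / 100
  add₁₄ := by ring
  mul₁₄ := by linear_combination -h.2 / 100

/-- Same linear solution for the branch points reflected by t = f₁ − x, which exchanges 0 and f₁ and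
reverses the order. -/
theorem ConditionB.coverData {f₁ f₂ f₃ f₄ : ℝ} (h : ConditionB f₁ f₂ f₃ f₄) (h₄ : 0 < f₄)
    (h₄₃ : f₄ < f₃) (h₃₂ : f₃ < f₂) (h₂₁ : f₂ < f₁) :
    CoverData f₁ (f₁ - f₄) (f₁ - f₃) (f₁ - f₂) ((2 * (f₃ + f₄) - 3 * f₂ + 2 * f₁) / 10)
      ((2 * f₂ + 2 * f₁ - 3 * (f₃ + f₄)) / 10) where
  pos₄ := by linarith
  lt₄₃ := by linarith
  lt₃₂ := by linarith
  lt₂₁ := by linarith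
  add₂₃ := by ring
  mul₂₃ := by linear_combination h.1 / 100
  add₁₄ := by ring
  mul₁₄ := by linear_combination -h.2 / 100

theorem alphaPeriod₂_eq_three_mul {b : Fin 4 → ℝ} (h₀ : 0 < b 0) (h₀₁ : b 0 < b 1)
    (h₁₂ : b 1 < b 2) (h₂₃ : b 2 < b 3)
    (h : ConditionA (1 / b 0) (1 / b 1) (1 / b 2) (1 / b 3)) :
    alphaPeriod₂ b 2 = 3 * alphaPeriod₁ b 2 := by
  have h₁ := h₀.trans h₀₁
  have h₂ := h₁.trans h₁₂
  have h₃ := h₂.trans h₂₃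
  have hb : ∀ i, 0 < b i := by
    intro i
    fin_cases i <;> assumption
  have hdata := h.coverData (one_div_pos.2 h₃) (one_div_lt_one_div_of_lt h₂ h₂₃)
    (one_div_lt_one_div_of_lt h₁ h₁₂) (one_div_lt_one_div_of_lt h₀ h₀₁)
  rw [alphaPeriod₂, alphaPeriod₁, integral_curvePoly_eq_mul_integral hb h₂ h₂₃,
    integral_curvePoly_eq_mul_integral hb h₀ h₀₁, hdata.integral_eq_three_mul]
  ring

theorem alphaPeriod₂_eq_two_mul {b : Fin 4 → ℝ} (h₀ : 0 < b 0) (h₀₁ : b 0 < b 1)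
    (h₁₂ : b 1 < b 2) (h₂₃ : b 2 < b 3)
    (h : ConditionB (1 / b 0) (1 / b 1) (1 / b 2) (1 / b 3)) :
    alphaPeriod₂ b 2 = 2 * alphaPeriod₁ b 2 := by
  have h₁ := h₀.trans h₀₁
  have h₂ := h₁.trans h₁₂
  have h₃ := h₂.trans h₂₃
  have hb : ∀ i, 0 < b i := by
    intro i
    fin_cases i <;> assumption
  have hdata := h.coverData (one_div_pos.2 h₃) (one_div_lt_one_div_of_lt h₂ h₂₃)
    (one_div_lt_one_div_of_lt h₁ h₁₂) (one_div_lt_one_div_of_lt h₀ h₀₁)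
  -- The reflection flips the sign of the quintic and takes [f₂, f₁] to [0, F₄] and [f₄, f₃] to [F₃,
  -- F₂].
  have hreflect : ∀ x : ℝ, -1 * (x *
      ((x - 1 / b 0) * (x - 1 / b 1) * (x - 1 / b 2) * (x - 1 / b 3))) =
      (fun t : ℝ => 1 * (t * ((t - 1 / b 0) * (t - (1 / b 0 - 1 / b 3)) *
        (t - (1 / b 0 - 1 / b 2)) * (t - (1 / b 0 - 1 / b 1))))) (1 / b 0 - x) := by
    intro x
    ring
  rw [alphaPeriod₂, alphaPeriod₁, integral_curvePoly_eq_mul_integral hb h₂ h₂₃,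
    integral_curvePoly_eq_mul_integral hb h₀ h₀₁]
  simp only [hreflect]
  rw [intervalIntegral.integral_comp_sub_left (fun t : ℝ => 1 / √(1 * (t * ((t - 1 / b 0) *
      (t - (1 / b 0 - 1 / b 3)) * (t - (1 / b 0 - 1 / b 2)) * (t - (1 / b 0 - 1 / b 1)))))),
    intervalIntegral.integral_comp_sub_left (fun t : ℝ => 1 / √(1 * (t * ((t - 1 / b 0) *
      (t - (1 / b 0 - 1 / b 3)) * (t - (1 / b 0 - 1 / b 2)) * (t - (1 / b 0 - 1 / b 1)))))),
    hdata.integral_eq_two_mul, sub_self]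
  ring

/-! ### Bounds on the periods, periodicity and the period mapping -/

theorem intervalIntegrable_alpha₁ {b : Fin 4 → ℝ} (h₀ : 0 < b 0) (h₀₁ : b 0 < b 1)
    (h₁₂ : b 1 < b 2) (h₂₃ : b 2 < b 3) (n : ℕ) :
    IntervalIntegrable (fun x => x ^ n / √((curvePoly b).eval x)) volume (b 0) (b 1) := by
  refine intervalIntegrable_div_sqrt h₀₁ (u := fun x => x * (b 2 - x) * (b 3 - x))
    (by fun_prop) (fun x hx => ?_) (by fun_prop) (fun x _ => by rw [curvePoly_eval]; ring)
  exact mul_pos (mul_pos (by linarith [hx.1]) (by linarith [hx.2])) (by linarith [hx.2])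

theorem intervalIntegrable_alpha₂ {b : Fin 4 → ℝ} (h₀ : 0 < b 0) (h₀₁ : b 0 < b 1)
    (h₁₂ : b 1 < b 2) (h₂₃ : b 2 < b 3) (n : ℕ) :
    IntervalIntegrable (fun x => x ^ n / √((curvePoly b).eval x)) volume (b 2) (b 3) := by
  refine intervalIntegrable_div_sqrt h₂₃ (u := fun x => x * (x - b 0) * (x - b 1))
    (by fun_prop) (fun x hx => ?_) (by fun_prop) (fun x _ => by rw [curvePoly_eval]; ring)
  exact mul_pos (mul_pos (by linarith [hx.1]) (by linarith [hx.1])) (by linarith [hx.1])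

theorem alphaPeriod₁_pos {b : Fin 4 → ℝ} (h₀ : 0 < b 0) (h₀₁ : b 0 < b 1)
    (h₁₂ : b 1 < b 2) (h₂₃ : b 2 < b 3) : 0 < alphaPeriod₁ b 2 := by
  refine mul_pos two_pos (intervalIntegral.intervalIntegral_pos_of_pos_on
    (intervalIntegrable_alpha₁ h₀ h₀₁ h₁₂ h₂₃ _) (fun x hx => ?_) h₀₁)
  have hx0 : 0 < x := h₀.trans hx.1
  refine div_pos (pow_pos hx0 _) (Real.sqrt_pos.2 ?_)
  rw [curvePoly_eval]
  have h1 : 0 < x * ((x - b 0) * (b 1 - x) * (b 2 - x) * (b 3 - x)) :=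
    mul_pos hx0 (mul_pos (mul_pos (mul_pos (by linarith [hx.1]) (by linarith [hx.2]))
      (by linarith [hx.2])) (by linarith [hx.2]))
  linarith

theorem alphaPeriod₁_le {b : Fin 4 → ℝ} (h₀ : 0 < b 0) (h₀₁ : b 0 < b 1)
    (h₁₂ : b 1 < b 2) (h₂₃ : b 2 < b 3) : alphaPeriod₁ b 2 ≤ b 1 * alphaPeriod₁ b 1 := by
  rw [alphaPeriod₁, alphaPeriod₁, mul_left_comm, ← intervalIntegral.integral_const_mul (b 1)]
  refine mul_le_mul_of_nonneg_left (intervalIntegral.integral_mono_on h₀₁.le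
    (intervalIntegrable_alpha₁ h₀ h₀₁ h₁₂ h₂₃ _)
    ((intervalIntegrable_alpha₁ h₀ h₀₁ h₁₂ h₂₃ _).const_mul _) fun x hx => ?_) two_pos.le
  rw [mul_div_assoc']
  gcongr
  simpa using hx.2

theorem le_alphaPeriod₂ {b : Fin 4 → ℝ} (h₀ : 0 < b 0) (h₀₁ : b 0 < b 1)
    (h₁₂ : b 1 < b 2) (h₂₃ : b 2 < b 3) : b 2 * alphaPeriod₂ b 1 ≤ alphaPeriod₂ b 2 := by
  rw [alphaPeriod₂, alphaPeriod₂, mul_left_comm, ← intervalIntegral.integral_const_mul (b 2)]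
  refine mul_le_mul_of_nonneg_left (intervalIntegral.integral_mono_on h₂₃.le
    ((intervalIntegrable_alpha₂ h₀ h₀₁ h₁₂ h₂₃ _).const_mul _)
    (intervalIntegrable_alpha₂ h₀ h₀₁ h₁₂ h₂₃ _) fun x hx => ?_) two_pos.le
  rw [mul_div_assoc']
  gcongr
  simpa using hx.1

/-- If the periods of `ω₂` have an integral ratio, then the geodesics are closed: on the first oval
`λ ≤ b₂`, on the second `λ ≥ b₃ > b₂`, so the period of `ω₁` cannot vanish as well. -/
theorem realPeriodicity_of_eq_mul {b : Fin 4 → ℝ} (h₀ : 0 < b 0) (h₀₁ : b 0 < b 1)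
    (h₁₂ : b 1 < b 2) (h₂₃ : b 2 < b 3) {n : ℕ} (hn : 0 < n)
    (h : alphaPeriod₂ b 2 = n * alphaPeriod₁ b 2) : RealPeriodicity b := by
  -- The cycle nα₁ − α₂ annihilates ω₂; T is its ω₁-period, and only positivity needs an argument.
  refine ⟨n, -1, n * alphaPeriod₁ b 1 - alphaPeriod₂ b 1, by simp, ?_, by push_cast; ring,
    by push_cast; rw [h]; ring⟩
  have hn' : (0 : ℝ) < n := Nat.cast_pos.2 hn
  have hpos := mul_pos hn' (alphaPeriod₁_pos h₀ h₀₁ h₁₂ h₂₃)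
  have h1 := mul_le_mul_of_nonneg_left (alphaPeriod₁_le h₀ h₀₁ h₁₂ h₂₃) hn'.le
  have h2 := le_alphaPeriod₂ h₀ h₀₁ h₁₂ h₂₃
  have hb₁ := h₀.trans h₀₁
  have hY : 0 < n * alphaPeriod₁ b 1 := by
    refine pos_of_mul_pos_right (a := b 1) ?_ hb₁.le
    linarith
  have h3 : b 1 * (n * alphaPeriod₁ b 1) < b 2 * (n * alphaPeriod₁ b 1) :=
    mul_lt_mul_of_pos_right h₁₂ hY
  have h4 : b 2 * alphaPeriod₂ b 1 < b 2 * (n * alphaPeriod₁ b 1) := by linarith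
  linarith [lt_of_mul_lt_mul_left h4 (hb₁.trans h₁₂).le]

theorem branchPoints_lt {a₁ a₂ a₃ c : ℝ} (ha₁₂ : a₁ < a₂) (ha₂₃ : a₂ < a₃)
    (hc₁ : a₁ < c) (hc₃ : c < a₃) (hc₂ : c ≠ a₂) :
    branchPoints a₁ a₂ a₃ c 0 = a₁ ∧ branchPoints a₁ a₂ a₃ c 0 < branchPoints a₁ a₂ a₃ c 1 ∧
      branchPoints a₁ a₂ a₃ c 1 < branchPoints a₁ a₂ a₃ c 2 ∧
      branchPoints a₁ a₂ a₃ c 2 < branchPoints a₁ a₂ a₃ c 3 := by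
  rcases hc₂.lt_or_gt with h | h
  · simp [branchPoints, h, hc₁, ha₂₃]
  · simp [branchPoints, h.not_gt, ha₁₂, h, hc₃]

/-- The value of the period mapping from the ratio of the two periods of `ω₂`. -/
theorem periodMapping_of_eq_mul {a₁ a₂ a₃ c n : ℝ} (hn : n ≠ 0)
    (h₁ : alphaPeriod₁ (branchPoints a₁ a₂ a₃ c) 2 ≠ 0)
    (h : alphaPeriod₂ (branchPoints a₁ a₂ a₃ c) 2 = n * alphaPeriod₁ (branchPoints a₁ a₂ a₃ c) 2) :
    (c < a₂ → periodMapping a₁ a₂ a₃ c = n) ∧ (a₂ < c → periodMapping a₁ a₂ a₃ c = 1 / n) := by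
  constructor
  · intro hc
    rw [periodMapping, if_pos hc, h]
    field_simp
  · intro hc
    rw [periodMapping, if_neg hc.not_gt, h]
    field_simp

theorem proposition6p4 (a₁ a₂ a₃ c : ℝ) (ha₁ : 0 < a₁) (ha₁₂ : a₁ < a₂) (ha₂₃ : a₂ < a₃)
    (hc₁ : a₁ < c) (hc₃ : c < a₃) (hc₂ : c ≠ a₂)
    (b : Fin 4 → ℝ) (hb : b = branchPoints a₁ a₂ a₃ c)
    (hcover : IsRealTangentialCover b 4) :
    (ConditionA (1 / b 0) (1 / b 1) (1 / b 2) (1 / b 3) →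
      RealPeriodicity b ∧
      (c < a₂ → periodMapping a₁ a₂ a₃ c = 3) ∧
      (a₂ < c → periodMapping a₁ a₂ a₃ c = 1 / 3)) ∧
    (ConditionB (1 / b 0) (1 / b 1) (1 / b 2) (1 / b 3) →
      RealPeriodicity b ∧
      (c < a₂ → periodMapping a₁ a₂ a₃ c = 2) ∧
      (a₂ < c → periodMapping a₁ a₂ a₃ c = 1 / 2)) := by
  obtain ⟨h₀, h₀₁, h₁₂, h₂₃⟩ := branchPoints_lt ha₁₂ ha₂₃ hc₁ hc₃ hc₂
  subst hb
  have hpos : 0 < branchPoints a₁ a₂ a₃ c 0 := ha₁.trans_eq h₀.symm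
  have hne := (alphaPeriod₁_pos hpos h₀₁ h₁₂ h₂₃).ne'
  constructor
  · intro h
    have hratio := alphaPeriod₂_eq_three_mul hpos h₀₁ h₁₂ h₂₃ h
    exact ⟨realPeriodicity_of_eq_mul hpos h₀₁ h₁₂ h₂₃ three_pos (by exact_mod_cast hratio),
      periodMapping_of_eq_mul three_ne_zero hne hratio⟩
  · intro h
    have hratio := alphaPeriod₂_eq_two_mul hpos h₀₁ h₁₂ h₂₃ h
    exact ⟨realPeriodicity_of_eq_mul hpos h₀₁ h₁₂ h₂₃ two_pos (by exact_mod_cast hratio),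
      periodMapping_of_eq_mul two_ne_zero hne hratio⟩
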